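/- For a finite graph $G$ with $n$ vertices and $k$ connected components and an integer $h\ge 0$, let $\mathrm{Lip}(G;h)$ be the set of functions $f:V(G)\to\mathbb{Z}$ that vanish at one fixed vertex of each connected component of $G$ and satisfy $|f(x)-f(y)|\le h$ for every edge $\{x,y\}$ of $G$ (its cardinality does not depend on the choice of the fixed vertices). If $k<n$, let $c(G)=\lim_{h\to\infty}\frac1h\,|\mathrm{Lip}(G;h)|^{1/(n-k)}$. Let $G(n,d/n)$ be the random graph on $n$ vertices in which each pair of distinct vertices is joined by an edge independently with probability $d/n$ (for $n\ge d$). Theorem. There is an absolute constant $C$ such that for every fixed real $d>0$, $$\lim_{n\to\infty}\mathbf{Pr}\left[\,c(G(n,d/n))\text{ is defined and } c(G(n,d/n))\le 1+\frac{4\ln^2 d}{d}+\frac{C}{d}\,\right]=1,$$ where "$c(G)$ is defined" means that $k<n$ and the limit defining $c(G)$ exists. -/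

import Mathlib

open Filter Topology MeasureTheory

namespace LipschitzCount

/-- The vertex chosen in the connected component `K`, at which Lipschitz functions vanish.
The choice is immaterial for the number of functions, see `ncard_lip_eq`. -/
noncomputable def root {V : Type*} (G : SimpleGraph V) (K : G.ConnectedComponent) : V :=
  Quot.out K

theorem root_mem {V : Type*} (G : SimpleGraph V) (K : G.ConnectedComponent) :
    G.connectedComponentMk (root G K) = K :=
  Quot.out_eq K

/-- `lip G r h`: the integer-valued `h`-Lipschitz functions on the vertices of `G` that vanish at
the vertex `r K` for every connected component `K` of `G`. -/
def lip {V : Type*} (G : SimpleGraph V) (r : G.ConnectedComponent → V) (h : ℕ) : Set (V → ℤ) :=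
  {f | (∀ K, f (r K) = 0) ∧ ∀ x y, G.Adj x y → |f x - f y| ≤ (h : ℤ)}

/-- The number `|Lip(G; h)|` of integer-valued `h`-Lipschitz functions on `G` that vanish at a fixed
vertex of each connected component. -/
noncomputable def lipCount {V : Type*} (G : SimpleGraph V) (h : ℕ) : ℕ :=
  (lip G (root G) h).ncard

/-- The number of vertices. -/
noncomputable def numVertices {V : Type*} (_G : SimpleGraph V) : ℕ := Nat.card V

/-- The number of connected components. -/
noncomputable def numComponents {V : Type*} (G : SimpleGraph V) : ℕ :=
  Nat.card G.ConnectedComponent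

/-- `(1 / h) * |Lip(G; h)| ^ (1 / (n - k))`, where `G` has `n` vertices and `k` components. -/
noncomputable def lipRate {V : Type*} (G : SimpleGraph V) (h : ℕ) : ℝ :=
  1 / (h : ℝ) * (lipCount G h : ℝ) ^ (1 / ((numVertices G : ℝ) - (numComponents G : ℝ)))

/-- `c(G)`, the limit of `lipRate G h` as `h → ∞`. -/
noncomputable def c {V : Type*} (G : SimpleGraph V) : ℝ := limUnder atTop (lipRate G)

/-- `c(G)` is well defined: `G` has fewer components than vertices, and the limit exists. -/
def HasC {V : Type*} (G : SimpleGraph V) : Prop :=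
  numComponents G < numVertices G ∧ Tendsto (lipRate G) atTop (𝓝 (c G))

/-- The edge probability `d / n`, an element of `[0, 1]` (it is `d / n` itself as soon as
`0 ≤ d ≤ n`, and `1` if `0 < n < d`). -/
noncomputable def edgeProb (d : ℝ) (n : ℕ) : unitInterval :=
  Set.projIcc (0 : ℝ) 1 zero_le_one (d / (n : ℝ))

theorem coe_edgeProb {d : ℝ} {n : ℕ} (hd : 0 ≤ d) (hn : d ≤ n) :
    (edgeProb d n : ℝ) = d / n := by
  have h0 : 0 ≤ d / (n : ℝ) := by positivity
  have h1 : d / (n : ℝ) ≤ 1 := div_le_one_of_le₀ hn (by positivity)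
  simp [edgeProb, Set.coe_projIcc, h0, h1]

/-- The law of the random graph `G(n, d / n)` on the vertex set `Fin n`: each pair of distinct
vertices is joined by an edge with probability `d / n`, independently of the other pairs. -/
noncomputable def randomGraph (n : ℕ) (d : ℝ) : Measure (SimpleGraph (Fin n)) :=
  SimpleGraph.binomialRandom (Fin n) (edgeProb d n)

/-- The set of functions counted is finite if `G` is. -/
theorem lip_finite {V : Type*} [Finite V] (G : SimpleGraph V) (r : G.ConnectedComponent → V)
    (hr : ∀ K, G.connectedComponentMk (r K) = K) (h : ℕ) : (lip G r h).Finite := by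
  have key : ∀ v, ∃ B : ℤ, ∀ f ∈ lip G r h, |f v| ≤ B := by
    intro v
    have hv : G.Reachable (r (G.connectedComponentMk v)) v :=
      SimpleGraph.ConnectedComponent.exact (hr _)
    obtain ⟨w⟩ := hv
    have walk : ∀ {a b : V} (w : G.Walk a b) (f : V → ℤ), f ∈ lip G r h →
        |f b - f a| ≤ w.length * h := by
      intro a b w f hf
      induction w with
      | nil => simp
      | @cons a m b hadj w ih =>
        have h1 := hf.2 _ _ hadj.symm
        have h2 : f b - f a = (f b - f m) + (f m - f a) := by ring
        rw [h2, SimpleGraph.Walk.length_cons]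
        refine (abs_add_le _ _).trans ?_
        push_cast
        linarith
    refine ⟨w.length * h, fun f hf => ?_⟩
    simpa [hf.1] using walk w f hf
  choose B hB using key
  refine (Set.Finite.pi' (fun v => Set.finite_Icc (-B v) (B v))).subset ?_
  intro f hf v
  exact abs_le.mp (hB v f hf)

/-- The number of functions does not depend on the vertices at which they are required to vanish. -/
theorem ncard_lip_eq {V : Type*} (G : SimpleGraph V) (r : G.ConnectedComponent → V)
    (hr : ∀ K, G.connectedComponentMk (r K) = K) (h : ℕ) :
    (lip G r h).ncard = lipCount G h := by
  have shift : ∀ (r s : G.ConnectedComponent → V), (∀ K, G.connectedComponentMk (s K) = K) →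
      ∀ f ∈ lip G r h, (fun v => f v - f (s (G.connectedComponentMk v))) ∈ lip G s h := by
    intro r s hs f hf
    refine ⟨fun K => by simp [hs], fun x y hxy => ?_⟩
    have : G.connectedComponentMk x = G.connectedComponentMk y :=
      SimpleGraph.ConnectedComponent.sound hxy.reachable
    simpa [this] using hf.2 x y hxy
  refine Set.ncard_congr (fun f _ v => f v - f (root G (G.connectedComponentMk v)))
    (fun f hf => shift r (root G) (root_mem G) f hf) ?_ ?_
  · intro f g hf hg hfg
    have e : ∀ v, f v - f (root G (G.connectedComponentMk v)) =
        g v - g (root G (G.connectedComponentMk v)) := fun v => congrFun hfg v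
    funext v
    have h1 := e v
    have h2 := e (r (G.connectedComponentMk v))
    rw [hr, hf.1, hg.1] at h2
    linarith
  · intro g hg
    refine ⟨_, shift (root G) r hr g hg, ?_⟩
    funext v
    simp [root_mem, hg.1]

end LipschitzCount

namespace LipschitzCount

/-! Call two disjoint `m`-sets with no edge between them a hole. A first-moment bound shows that
`G(n, d/n)` has, with probability tending to one, no hole with `m = ⌈αn⌉`, as soon as `2(1 - ln α) <
dα` (`binomialRandom_hasHole_le`).

Without holes a Lipschitz function is concentrated. Let `f v₀` be its `m`-th smallest value. The `m`
vertices with value at most `f v₀` have no neighbour with value above `f v₀ + h`, so fewer than `m`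
vertices lie above, and fewer than `m` lie below `f v₀`. Hence all values outside a set `S` of `2m`
vertices lie in one window of `h + 1` integers. Once `v₀` and `S` are chosen, a vertex outside `S`
has `h + 1` options and a vertex of `S` at most `2h + 1`, relative to its parent in a spanning
forest. This gives `lipCount_le_of_not_hasHole`: the excess over `(h + 1) ^ (n - k)` is at most `n *
n.choose (2m) * 2 ^ (2m)`.

Taking the `(n - k)`-th root, with `k < 2m`, bounds `c(G)` by about `exp (dα² / (1 - 2α))`. The
choice `α = 2(ln d - 1)/d` makes this at most `1 + 4 ln² d / d` for large `d`
(`eventually_exp_bound`). For bounded `d` the trivial bound `c(G) ≤ 2` suffices, since `C/d ≥ 1`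
there. -/

/-! ### First-moment bound for holes. -/

theorem binomialRandom_no_edge_le {V : Type*} [Finite V] (p : unitInterval) (E : Finset (Sym2 V))
    (hE : ∀ e ∈ E, ¬ e.IsDiag) :
    SimpleGraph.binomialRandom V p {G | ∀ e ∈ E, e ∉ G.edgeSet} ≤
      ENNReal.ofReal ((1 - (p : ℝ)) ^ E.card) := by
  rw [SimpleGraph.binomialRandom_apply']
  calc _ ≤ ProbabilityTheory.setBernoulli (Sym2.diagSetᶜ : Set (Sym2 V)) p
        {t | ∀ e ∈ E, e ∉ t} := by
        refine measure_mono ?_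
        rintro _ ⟨G, hG, rfl⟩
        exact hG
    _ = ∏ e ∈ E, (unitInterval.toNNReal (unitInterval.symm p) : ENNReal) := by
        rw [ProbabilityTheory.setBernoulli_apply']
        have : ((fun q : Sym2 V → Prop ↦ {i | q i}) ⁻¹' {t : Set (Sym2 V) | ∀ e ∈ E, e ∉ t}) =
            Set.pi E (fun _ => ({False} : Set Prop)) := by
          ext q; simp [Set.mem_pi]
        rw [this, Measure.infinitePi_pi _ (fun _ _ => .of_discrete)]
        refine Finset.prod_congr rfl fun e he => ?_
        have := hE e he
        simp [this]
    _ = _ := by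
        rw [Finset.prod_const, ENNReal.ofReal_pow (by linarith [p.2.2])]
        congr 1
        rw [ENNReal.ofReal, ENNReal.coe_inj]
        ext
        simp [p.2.2]

/-- Two disjoint sets of `m` vertices each with no edge between them. -/
def HasHole {V : Type*} (G : SimpleGraph V) (m : ℕ) : Prop :=
  ∃ A B : Finset V, A.card = m ∧ B.card = m ∧ Disjoint A B ∧ ∀ a ∈ A, ∀ b ∈ B, ¬ G.Adj a b

/-- Union bound over pairs of `m`-sets: disjointness makes the `m ^ 2` pairs between them distinct
edges, all absent with probability `(1 - p) ^ (m ^ 2)`. -/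
theorem binomialRandom_hasHole_le {V : Type*} [Fintype V] (p : unitInterval) (m : ℕ) :
    SimpleGraph.binomialRandom V p {G | HasHole G m} ≤
      ENNReal.ofReal (((Fintype.card V).choose m : ℝ) ^ 2 * (1 - (p : ℝ)) ^ (m ^ 2)) := by
  classical
  set P := (Finset.univ : Finset V).powersetCard m
  set T := (P ×ˢ P).filter fun q => Disjoint q.1 q.2
  set E : Finset V × Finset V → Finset (Sym2 V) := fun q => (q.1 ×ˢ q.2).image Sym2.mk.uncurry
  have hp : 0 ≤ 1 - (p : ℝ) := by linarith [p.2.2]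
  have hcard : ∀ q ∈ T, (E q).card = m ^ 2 := by
    intro q hq
    simp only [T, P, Finset.mem_filter, Finset.mem_product, Finset.mem_powersetCard] at hq
    rw [Finset.card_image_of_injOn, Finset.card_product, hq.1.1.2, hq.1.2.2, sq]
    rintro ⟨a, b⟩ hab ⟨a', b'⟩ hab' h
    simp only [Finset.coe_product, Set.mem_prod, Finset.mem_coe] at hab hab'
    simp only [Function.uncurry_apply_pair, Sym2.eq_iff] at h
    rcases h with h | h
    · simp [h]
    · exact absurd (h.1 ▸ hab.1) (Finset.disjoint_right.mp hq.2 hab'.2)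
  calc _ ≤ SimpleGraph.binomialRandom V p (⋃ q ∈ T, {G | ∀ e ∈ E q, e ∉ G.edgeSet}) := by
        refine measure_mono ?_
        rintro G ⟨A, B, hA, hB, hAB, h⟩
        simp only [Set.mem_iUnion]
        refine ⟨(A, B), by simp [T, P, hA, hB, hAB], ?_⟩
        simp only [E, Set.mem_ofPred_eq, Finset.mem_image, Finset.mem_product, Prod.exists]
        rintro _ ⟨a, b, ⟨ha, hb⟩, rfl⟩
        simpa using h a ha b hb
    _ ≤ ∑ q ∈ T, ENNReal.ofReal ((1 - (p : ℝ)) ^ (m ^ 2)) := by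
        refine (measure_biUnion_finset_le _ _).trans (Finset.sum_le_sum fun q hq => ?_)
        rw [← hcard q hq]
        refine binomialRandom_no_edge_le p _ fun e he => ?_
        simp only [E, Finset.mem_image, Finset.mem_product, Prod.exists] at he
        obtain ⟨a, b, ⟨ha, hb⟩, rfl⟩ := he
        have := (Finset.mem_filter.mp hq).2
        simpa using fun h : a = b => Finset.disjoint_left.mp this ha (h ▸ hb)
    _ ≤ _ := by
        rw [Finset.sum_const, nsmul_eq_mul, ENNReal.ofReal_mul (by positivity)]
        gcongr
        have h : T.card ≤ (Fintype.card V).choose m ^ 2 := by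
          refine (Finset.card_filter_le _ _).trans ?_
          simp [P, Finset.card_product, sq]
        rw [← Nat.cast_pow, ENNReal.ofReal_natCast]
        exact_mod_cast h

/-! ### Existence of the limit defining `c(G)`. -/

theorem root_injective {V : Type*} (G : SimpleGraph V) : Function.Injective (root G) :=
  fun K L h => by rw [← root_mem G K, h, root_mem]

theorem card_compl_range {V : Type*} [Finite V] (G : SimpleGraph V)
    {r : G.ConnectedComponent → V} (hr : Function.Injective r) :
    Nat.card {v // v ∉ Set.range r} = numVertices G - numComponents G := by
  classical
  cases nonempty_fintype V
  have h := Set.ncard_compl (Set.range r)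
  rw [← Nat.card_coe_set_eq, ← Nat.card_coe_set_eq, Nat.card_range_of_injective hr] at h
  exact h

theorem extendByZero_root {V : Type*} (G : SimpleGraph V)
    (g : {v // v ∉ Set.range (root G)} → ℝ) (K : G.ConnectedComponent) :
    Function.ExtendByZero.linearMap ℝ Subtype.val g (root G K) = 0 :=
  Function.extend_apply' g (0 : V → ℝ) _ fun ⟨a, ha⟩ => a.2 ⟨K, ha.symm⟩

theorem extendByZero_val {V : Type*} (G : SimpleGraph V)
    (g : {v // v ∉ Set.range (root G)} → ℝ) (v : {v // v ∉ Set.range (root G)}) :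
    Function.ExtendByZero.linearMap ℝ Subtype.val g v = g v :=
  Subtype.val_injective.extend_apply g (0 : V → ℝ) v

/-- The functions on the non-root vertices whose extension by zero is `1`-Lipschitz. -/
def lipBody {V : Type*} (G : SimpleGraph V) : Set ({v // v ∉ Set.range (root G)} → ℝ) :=
  {g | ∀ x y, G.Adj x y → |Function.ExtendByZero.linearMap ℝ Subtype.val g x -
    Function.ExtendByZero.linearMap ℝ Subtype.val g y| ≤ 1}

theorem convex_lipBody {V : Type*} (G : SimpleGraph V) : Convex ℝ (lipBody G) := by
  intro g hg g' hg' a b ha hb hab x y hxy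
  have h1 := abs_le.mp (hg x y hxy)
  have h2 := abs_le.mp (hg' x y hxy)
  simp only [map_add, map_smul, Pi.add_apply, Pi.smul_apply, smul_eq_mul]
  rw [abs_le]
  constructor <;> nlinarith

theorem isClosed_lipBody {V : Type*} [Finite V] (G : SimpleGraph V) : IsClosed (lipBody G) := by
  simp only [lipBody, Set.ofPred_forall]
  refine isClosed_iInter fun x => isClosed_iInter fun y => isClosed_iInter fun _ => ?_
  have hc : Continuous (Function.ExtendByZero.linearMap ℝ
      (Subtype.val : {v // v ∉ Set.range (root G)} → V)) :=
    LinearMap.continuous_of_finiteDimensional _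
  have h := fun x => (continuous_apply x).comp hc
  exact isClosed_le ((h x).sub (h y)).abs continuous_const

theorem isBounded_lipBody {V : Type*} [Fintype V] (G : SimpleGraph V) :
    Bornology.IsBounded (lipBody G) := by
  classical
  have walk : ∀ {a b : V} (w : G.Walk a b) (g), g ∈ lipBody G →
      |Function.ExtendByZero.linearMap ℝ Subtype.val g b -
        Function.ExtendByZero.linearMap ℝ Subtype.val g a| ≤ w.length := by
    intro a b w g hg
    induction w with
    | nil => simp
    | @cons a m b hadj w ih =>
      have h1 := hg _ _ hadj.symm
      refine (abs_sub_le _ (Function.ExtendByZero.linearMap ℝ Subtype.val g m) _).trans ?_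
      rw [SimpleGraph.Walk.length_cons]
      push_cast
      linarith
  have key : ∀ v : {v // v ∉ Set.range (root G)}, ∃ B : ℝ, ∀ g ∈ lipBody G, |g v| ≤ B := by
    intro v
    obtain ⟨w⟩ : G.Reachable (root G (G.connectedComponentMk v)) v :=
      SimpleGraph.ConnectedComponent.exact (root_mem G _)
    refine ⟨w.length, fun g hg => ?_⟩
    simpa only [extendByZero_val, extendByZero_root, sub_zero] using walk w g hg
  choose B hB using key
  refine (Metric.isBounded_Icc (-B) B).subset fun g hg => ?_
  exact ⟨fun v => (abs_le.mp (hB v g hg)).1, fun v => (abs_le.mp (hB v g hg)).2⟩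

-- Scaling by `1 / h` identifies `lip G (root G) h` with the points of the lattice `h⁻¹ ℤ^(n-k)` in
-- the polytope `lipBody G`.
open scoped Pointwise in
theorem card_lattice_lipBody {V : Type*} [Fintype V] (G : SimpleGraph V) {h : ℕ} (hh : 0 < h) :
    Nat.card ↑(lipBody G ∩ (h : ℝ)⁻¹ • (Submodule.span ℤ (Set.range
      (Pi.basisFun ℝ {v // v ∉ Set.range (root G)})) : Set ({v // v ∉ Set.range (root G)} → ℝ))) =
      lipCount G h := by
  classical
  have hh' : (0 : ℝ) < h := by exact_mod_cast hh
  have hspan : ∀ y : {v // v ∉ Set.range (root G)} → ℝ, y ∈ Submodule.span ℤ (Set.range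
      (Pi.basisFun ℝ {v // v ∉ Set.range (root G)})) ↔ ∀ i, ∃ z : ℤ, (z : ℝ) = y i := by
    intro y
    rw [Module.Basis.mem_span_iff_repr_mem]
    simp
  have hext : ∀ (f : V → ℤ), (∀ K, f (root G K) = 0) → ∀ v,
      Function.ExtendByZero.linearMap ℝ Subtype.val
        (fun i : {v // v ∉ Set.range (root G)} => (h : ℝ)⁻¹ * f i) v = (h : ℝ)⁻¹ * f v := by
    intro f hf v
    by_cases hv : v ∈ Set.range (root G)
    · obtain ⟨K, rfl⟩ := hv
      rw [hf, extendByZero_root, Int.cast_zero, mul_zero]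
    · exact extendByZero_val G _ ⟨v, hv⟩
  have hbody : ∀ (f : V → ℤ), (∀ K, f (root G K) = 0) →
      ((fun i : {v // v ∉ Set.range (root G)} => (h : ℝ)⁻¹ * f i) ∈ lipBody G ↔
        f ∈ lip G (root G) h) := by
    intro f hf
    simp only [lipBody, lip, Set.mem_ofPred_eq, hf, hext f hf, implies_true, true_and]
    refine forall_congr' fun x => forall_congr' fun y => imp_congr_right fun _ => ?_
    rw [← mul_sub, abs_mul, abs_of_pos (inv_pos.mpr hh'), inv_mul_le_iff₀ hh', mul_one]
    norm_cast
  rw [Nat.card_coe_set_eq, lipCount]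
  rw [← Set.InjOn.ncard_image (s := lip G (root G) h)
    (f := fun f (i : {v // v ∉ Set.range (root G)}) => (h : ℝ)⁻¹ * f i)]
  · congr 1
    ext g
    constructor
    · rintro ⟨hg, y, hy, rfl⟩
      choose z hz using (hspan y).mp hy
      classical
      set f : V → ℤ := fun v => if hv : v ∈ Set.range (root G) then 0 else z ⟨v, hv⟩
      have hf : ∀ K, f (root G K) = 0 := fun K => by simp [f]
      have hfg : (fun i : {v // v ∉ Set.range (root G)} => (h : ℝ)⁻¹ * f i) = (h : ℝ)⁻¹ • y := by
        funext i
        have := i.2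
        simp only [f, dif_neg this, Pi.smul_apply, smul_eq_mul, ← hz i]
      exact ⟨f, (hbody f hf).mp (hfg ▸ hg), hfg⟩
    · rintro ⟨f, hf, rfl⟩
      refine ⟨(hbody f hf.1).mpr hf, fun i => f i, (hspan _).mpr fun i => ⟨f i, rfl⟩, rfl⟩
  · intro f hf f' hf' hff
    funext v
    by_cases hv : v ∈ Set.range (root G)
    · obtain ⟨K, rfl⟩ := hv
      rw [hf.1, hf'.1]
    · have := congrFun hff ⟨v, hv⟩
      simpa [hh'.ne'] using this

/-- Lattice-point counting gives `lipCount G h / h ^ (n - k) → volume (lipBody G)`, the boundary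
being null by convexity. So the limit is the `(n - k)`-th root of that volume. -/
theorem hasC_of_numComponents_lt {V : Type*} [Finite V] (G : SimpleGraph V)
    (hk : numComponents G < numVertices G) : HasC G := by
  classical
  cases nonempty_fintype V
  refine ⟨hk, tendsto_nhds_limUnder ?_⟩
  have hfr : volume (frontier (lipBody G)) = 0 := (convex_lipBody G).addHaar_frontier _
  have hlim := tendsto_card_div_pow_atTop_volume (lipBody G) (isBounded_lipBody G)
    (isClosed_lipBody G).measurableSet hfr
  rw [← Nat.card_eq_fintype_card, card_compl_range G (root_injective G)] at hlim
  set N := numVertices G - numComponents G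
  have hN : (numVertices G : ℝ) - (numComponents G : ℝ) = N := by
    rw [Nat.cast_sub hk.le]
  have hN0 : N ≠ 0 := (Nat.sub_pos_of_lt hk).ne'
  refine ⟨_, (hlim.rpow_const (p := 1 / (N : ℝ)) (Or.inr (by positivity))).congr' ?_⟩
  filter_upwards [eventually_gt_atTop 0] with h hh
  have hh' : (0 : ℝ) < h := by exact_mod_cast hh
  rw [card_lattice_lipBody G hh, lipRate, hN, Real.div_rpow (by positivity) (by positivity),
    one_div, Real.pow_rpow_inv_natCast hh'.le hN0, div_eq_mul_inv, mul_comm, one_div]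

/-! ### Counting Lipschitz functions on a graph without holes. -/

theorem exists_adj_dist_lt {V : Type*} {G : SimpleGraph V} {u v : V} (h : G.Reachable u v)
    (huv : u ≠ v) : ∃ w, G.Adj w v ∧ G.dist u w < G.dist u v := by
  obtain ⟨p, hp⟩ := h.symm.exists_walk_length_eq_dist
  cases p with
  | nil => exact absurd rfl huv
  | @cons _ w _ hadj q =>
    refine ⟨w, hadj.symm, ?_⟩
    rw [G.dist_comm, G.dist_comm (u := u) (v := v), ← hp, SimpleGraph.Walk.length_cons]
    exact Nat.lt_succ_of_le (SimpleGraph.dist_le q)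

/-- A function is encoded by its increments along a forest of shortest paths at vertices of `S`, and
by its offset from `f v₀` elsewhere. The minimum in the exponent serves two uses: a small `S`, and
`S` equal to everything for the trivial bound. -/
theorem ncard_lip_concentrated_le {V : Type*} [Fintype V] (G : SimpleGraph V)
    (h : ℕ) (v₀ : V) (S : Finset V) :
    {f ∈ lip G (root G) h | ∀ v ∉ S, f v₀ ≤ f v ∧ f v ≤ f v₀ + h}.ncard ≤
      2 ^ min S.card (numVertices G - numComponents G) *
        (h + 1) ^ (numVertices G - numComponents G) := by
  classical
  -- The forest is re-rooted at `v₀` in its own component, so that offsets from `f v₀` and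
  -- increments have a common base; the number of non-roots is still `n - k`.
  set r := Function.update (root G) (G.connectedComponentMk v₀) v₀ with hrdef
  have hr : ∀ K, G.connectedComponentMk (r K) = K := by
    intro K
    by_cases hK : K = G.connectedComponentMk v₀
    · subst hK; simp [hrdef]
    · simp [hrdef, hK, root_mem]
  have hv₀ : r (G.connectedComponentMk v₀) = v₀ := by simp [hrdef]
  have hinj : Function.Injective r := fun K L hKL => by rw [← hr K, hKL, hr]
  rw [← card_compl_range G hinj, Nat.card_eq_fintype_card]
  have hpar : ∀ v, v ∉ Set.range r → ∃ u, G.Adj u v ∧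
      G.dist (r (G.connectedComponentMk v)) u < G.dist (r (G.connectedComponentMk v)) v :=
    fun v hv => exists_adj_dist_lt (SimpleGraph.ConnectedComponent.exact (hr _))
      fun e => hv ⟨_, e⟩
  choose p hadj hlt using hpar
  have hcomp : ∀ v hv, G.connectedComponentMk (p v hv) = G.connectedComponentMk v :=
    fun v hv => SimpleGraph.ConnectedComponent.sound (hadj v hv).reachable
  set code : (V → ℤ) → {v // v ∉ Set.range r} → ℤ := fun f v =>
    if v.1 ∈ S then f v - f (p v v.2) else f v - f v₀ with hcode
  set T : Finset ({v // v ∉ Set.range r} → ℤ) := Fintype.piFinset fun v =>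
    if v.1 ∈ S then Finset.Icc (-(h : ℤ)) h else Finset.Icc 0 (h : ℤ)
  have hmaps : ∀ f ∈ {f ∈ lip G (root G) h | ∀ v ∉ S, f v₀ ≤ f v ∧ f v ≤ f v₀ + h},
      code f ∈ (T : Set ({v // v ∉ Set.range r} → ℤ)) := by
    rintro f ⟨hf, hfS⟩
    simp only [T, Finset.mem_coe, Fintype.mem_piFinset]
    intro v
    by_cases hv : v.1 ∈ S
    · have := abs_le.mp (hf.2 _ _ (hadj v v.2).symm)
      simpa [hcode, hv] using this
    · have := hfS v hv
      simp only [hcode, hv, if_false, Finset.mem_Icc]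
      constructor <;> linarith
  have hinjOn : Set.InjOn code
      {f ∈ lip G (root G) h | ∀ v ∉ S, f v₀ ≤ f v ∧ f v ≤ f v₀ + h} := by
    rintro f ⟨hf, -⟩ g ⟨hg, -⟩ hfg
    have hstep : ∀ v (hv : v ∉ Set.range r), f v - g v = f (p v hv) - g (p v hv) ∨
        f v - g v = f v₀ - g v₀ := by
      intro v hv
      have := congrFun hfg ⟨v, hv⟩
      by_cases hS : v ∈ S
      · left; simp only [hcode, hS, if_true] at this; linarith
      · right; simp only [hcode, hS, if_false] at this; linarith
    -- If the codes of `f` and `g` agree, then `f - g` at a non-root equals its value at the parent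
    -- or at `v₀`. It is thus constant on the component of `v₀`, where the original root forces it
    -- to be zero; then it vanishes on the other components too.
    have hroot₀ : ∀ N v, G.dist (r (G.connectedComponentMk v)) v = N →
        G.connectedComponentMk v = G.connectedComponentMk v₀ → f v - g v = f v₀ - g v₀ := by
      intro N
      induction N using Nat.strong_induction_on with
      | _ N ih =>
        rintro v rfl hv
        by_cases hvr : v ∈ Set.range r
        · obtain ⟨K, rfl⟩ := hvr
          rw [hr] at hv
          rw [hv, hv₀]
        · rcases hstep v hvr with h1 | h1
          · rw [h1]
            exact ih _ (by rw [hcomp]; exact hlt v hvr) _ rfl (by rw [hcomp, hv])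
          · exact h1
    have hzero : f v₀ - g v₀ = 0 := by
      rw [← hroot₀ _ _ rfl (root_mem G (G.connectedComponentMk v₀)), hf.1, hg.1, sub_zero]
    have hall : ∀ N v, G.dist (r (G.connectedComponentMk v)) v = N → f v - g v = 0 := by
      intro N
      induction N using Nat.strong_induction_on with
      | _ N ih =>
        rintro v rfl
        by_cases hvr : v ∈ Set.range r
        · obtain ⟨K, rfl⟩ := hvr
          by_cases hK : K = G.connectedComponentMk v₀
          · rw [hK, hv₀, hzero]
          · simp only [hrdef, Function.update_of_ne hK]
            rw [hf.1, hg.1, sub_zero]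
        · rcases hstep v hvr with h1 | h1
          · rw [h1]
            exact ih _ (by rw [hcomp]; exact hlt v hvr) _ rfl
          · rw [h1, hzero]
    funext v
    exact sub_eq_zero.mp (hall _ v rfl)
  refine (Set.ncard_le_ncard_of_injOn code hmaps hinjOn T.finite_toSet).trans ?_
  rw [Set.ncard_coe_finset, Fintype.card_piFinset]
  have hfac : ∀ v : {v // v ∉ Set.range r},
      (if v.1 ∈ S then Finset.Icc (-(h : ℤ)) h else Finset.Icc 0 (h : ℤ)).card ≤
        (if v.1 ∈ S then 2 else 1) * (h + 1) := by
    intro v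
    split_ifs
    · simp; omega
    · simp
  refine (Finset.prod_le_prod' fun v _ => hfac v).trans ?_
  rw [Finset.prod_mul_distrib, Finset.prod_const, Finset.card_univ]
  refine Nat.mul_le_mul_right _ ?_
  rw [Finset.prod_ite, Finset.prod_const, Finset.prod_const_one, mul_one]
  refine Nat.pow_le_pow_right two_pos (le_min ?_ (Finset.card_le_univ _))
  exact Finset.card_le_card_of_injOn Subtype.val (fun v hv => by simpa using hv)
    Subtype.val_injective.injOn

theorem lipCount_le_two_pow {V : Type*} [Finite V] (G : SimpleGraph V) (h : ℕ) :
    lipCount G h ≤ 2 ^ (numVertices G - numComponents G) *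
      (h + 1) ^ (numVertices G - numComponents G) := by
  cases nonempty_fintype V
  rcases isEmpty_or_nonempty V with hV | ⟨⟨v₀⟩⟩
  · refine (Set.ncard_le_one_of_subsingleton _).trans (Nat.succ_le_of_lt (by positivity))
  · have := ncard_lip_concentrated_le G h v₀ Finset.univ
    simp only [Finset.mem_univ, not_true_eq_false, false_imp_iff, implies_true, and_true] at this
    refine this.trans ?_
    gcongr
    · norm_num
    · exact min_le_right _ _

/-- Take the least value with at least `m` vertices at or below it. Were `m` vertices strictly
below, the largest of their values would be a smaller candidate. -/
theorem exists_order_statistic {V : Type*} [Fintype V] (f : V → ℤ) {m : ℕ} (hm : 0 < m)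
    (hmV : m ≤ Fintype.card V) :
    ∃ v₀, (Finset.univ.filter fun v => f v < f v₀).card < m ∧
      m ≤ (Finset.univ.filter fun v => f v ≤ f v₀).card := by
  have hV : Nonempty V := Fintype.card_pos_iff.mp (hm.trans_le hmV)
  obtain ⟨t, -, ht⟩ := Finset.exists_max_image Finset.univ f Finset.univ_nonempty
  obtain ⟨v₀, hv₀, hmin⟩ := Finset.exists_min_image
    (Finset.univ.filter fun u => m ≤ (Finset.univ.filter fun v => f v ≤ f u).card) f
    ⟨t, by
      rw [Finset.mem_filter, Finset.filter_true_of_mem fun v _ => ht v (Finset.mem_univ v)]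
      exact ⟨Finset.mem_univ _, hmV⟩⟩
  refine ⟨v₀, ?_, (Finset.mem_filter.mp hv₀).2⟩
  by_contra! hle
  obtain ⟨u, hu, hmax⟩ := Finset.exists_max_image (Finset.univ.filter fun v => f v < f v₀) f
    (Finset.card_pos.mp (hm.trans_le hle))
  have hlt := (Finset.mem_filter.mp hu).2
  refine hlt.not_ge (hmin u (Finset.mem_filter.mpr ⟨Finset.mem_univ _, hle.trans ?_⟩))
  exact Finset.card_le_card fun v hv => by simpa using hmax v hv

theorem lipCount_le_of_not_hasHole {V : Type*} [Fintype V] (G : SimpleGraph V) {m : ℕ}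
    (hm : 0 < m) (hmV : 2 * m ≤ Fintype.card V) (hG : ¬ HasHole G m) (h : ℕ) :
    lipCount G h ≤ Fintype.card V * (Fintype.card V).choose (2 * m) *
      (2 ^ (2 * m) * (h + 1) ^ (numVertices G - numComponents G)) := by
  classical
  set I := (Finset.univ : Finset V) ×ˢ (Finset.univ : Finset V).powersetCard (2 * m)
  set F : V × Finset V → Set (V → ℤ) := fun q =>
    {f ∈ lip G (root G) h | ∀ v ∉ q.2, f q.1 ≤ f v ∧ f v ≤ f q.1 + h}
  have hcover : lip G (root G) h ⊆ ⋃ q ∈ I, F q := by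
    intro f hf
    obtain ⟨v₀, hlow, hmid⟩ := exists_order_statistic f hm (by omega)
    have hhigh : (Finset.univ.filter fun v => f v₀ + h < f v).card < m := by
      by_contra! hle
      obtain ⟨A, hA, hAm⟩ := Finset.exists_subset_card_eq hmid
      obtain ⟨B, hB, hBm⟩ := Finset.exists_subset_card_eq hle
      have hAB : ∀ a ∈ A, ∀ b ∈ B, (h : ℤ) < f b - f a := by
        intro a ha b hb
        have h1 := (Finset.mem_filter.mp (hA ha)).2
        have h2 := (Finset.mem_filter.mp (hB hb)).2
        linarith
      refine hG ⟨A, B, hAm, hBm, Finset.disjoint_left.mpr fun a ha hb => ?_,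
        fun a ha b hb hadj => ?_⟩
      · have := hAB a ha a hb
        omega
      · exact ((hAB a ha b hb).trans_le (le_abs_self _)).not_ge (hf.2 b a hadj.symm)
    -- Padding the exceptional set to exactly `2 * m` vertices lets a single binomial coefficient
    -- count the choices.
    obtain ⟨S, hS, hScard⟩ := Finset.exists_superset_card_eq
      (s := (Finset.univ.filter fun v => f v < f v₀) ∪ Finset.univ.filter fun v => f v₀ + h < f v)
      (n := 2 * m) ((Finset.card_union_le _ _).trans (by omega)) hmV
    simp only [Set.mem_iUnion]
    refine ⟨(v₀, S), by simp [I, hScard], hf, fun v hv => ?_⟩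
    have := fun hmem => hv (hS hmem)
    simp only [Finset.mem_union, Finset.mem_filter, Finset.mem_univ, true_and, not_or, imp_false,
      not_lt] at this
    exact this
  have hfin : (⋃ q ∈ I, F q).Finite :=
    I.finite_toSet.biUnion fun q _ => (lip_finite G _ (root_mem G) h).subset fun f hf => hf.1
  refine (Set.ncard_le_ncard hcover hfin).trans ((Finset.set_ncard_biUnion_le I F).trans ?_)
  have hbound : ∀ q ∈ I, (F q).ncard ≤
      2 ^ (2 * m) * (h + 1) ^ (numVertices G - numComponents G) := by
    intro q hq
    have hq2 : q.2.card = 2 * m := by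
      simpa [I] using hq
    refine (ncard_lip_concentrated_le G h q.1 q.2).trans ?_
    rw [← hq2]
    gcongr
    · norm_num
    · exact min_le_left _ _
  refine (Finset.sum_le_card_nsmul _ _ _ hbound).trans (le_of_eq ?_)
  simp [I, Finset.card_product]

/-- Roots of distinct components are never adjacent, so `2 * m` of them would split into a hole.
This keeps `n - k` above `n - 2m` when the root is taken. -/
theorem numComponents_lt_of_not_hasHole {V : Type*} [Finite V] (G : SimpleGraph V) {m : ℕ}
    (hG : ¬ HasHole G m) : numComponents G < 2 * m := by
  classical
  cases nonempty_fintype V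
  by_contra! hle
  set R : Finset V := Finset.univ.filter fun v => v ∈ Set.range (root G)
  have hR : R.card = numComponents G := by
    rw [numComponents, ← Nat.card_range_of_injective (root_injective G), Nat.card_coe_set_eq,
      ← Set.ncard_coe_finset]
    simp [R]
  obtain ⟨A, hA, hAm⟩ := Finset.exists_subset_card_eq (s := R) (n := m) (by omega)
  obtain ⟨B, hB, hBm⟩ := Finset.exists_subset_card_eq (s := R \ A) (n := m)
    (by rw [Finset.card_sdiff_of_subset hA]; omega)
  have hdisj : Disjoint A B :=
    Finset.disjoint_left.mpr fun a ha hb => (Finset.mem_sdiff.mp (hB hb)).2 ha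
  refine hG ⟨A, B, hAm, hBm, hdisj, fun a ha b hb hadj => ?_⟩
  obtain ⟨K, rfl⟩ := (Finset.mem_filter.mp (hA ha)).2
  obtain ⟨L, rfl⟩ := (Finset.mem_filter.mp (Finset.mem_sdiff.mp (hB hb)).1).2
  have hKL := SimpleGraph.ConnectedComponent.sound hadj.reachable
  rw [root_mem, root_mem] at hKL
  subst hKL
  exact G.loopless.irrefl _ hadj

/-! ### From counts to bounds on `c(G)`, and binomial estimates. -/

theorem c_le_of_lipCount_le {V : Type*} (G : SimpleGraph V) (hG : HasC G) {B : ℝ}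
    (hB : 0 ≤ B) (h : ∀ h : ℕ, (lipCount G h : ℝ) ≤
      B * ((h : ℝ) + 1) ^ (numVertices G - numComponents G)) :
    c G ≤ B ^ (1 / ((numVertices G : ℝ) - (numComponents G : ℝ))) := by
  have hN : (numVertices G : ℝ) - (numComponents G : ℝ) =
      (numVertices G - numComponents G : ℕ) := by rw [Nat.cast_sub hG.1.le]
  have hN0 : numVertices G - numComponents G ≠ 0 := (Nat.sub_pos_of_lt hG.1).ne'
  have hlim : Tendsto (fun h : ℕ => (1 + 1 / (h : ℝ)) *
      B ^ (1 / ((numVertices G : ℝ) - (numComponents G : ℝ)))) atTop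
      (𝓝 ((1 + 0) * B ^ (1 / ((numVertices G : ℝ) - (numComponents G : ℝ))))) :=
    (tendsto_const_nhds.add tendsto_one_div_atTop_nhds_zero_nat).mul_const _
  rw [add_zero, one_mul] at hlim
  refine le_of_tendsto_of_tendsto hG.2 hlim ?_
  filter_upwards [eventually_gt_atTop 0] with k hk
  have hk' : (0 : ℝ) < k := by exact_mod_cast hk
  rw [lipRate, hN]
  calc _ ≤ 1 / (k : ℝ) * (B * ((k : ℝ) + 1) ^ (numVertices G - numComponents G)) ^
        (1 / ((numVertices G - numComponents G : ℕ) : ℝ)) := by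
        gcongr
        exact h k
    _ = _ := by
        rw [Real.mul_rpow hB (by positivity),
          one_div ((numVertices G - numComponents G : ℕ) : ℝ),
          Real.pow_rpow_inv_natCast (by positivity) hN0]
        field_simp

theorem c_le_two {V : Type*} [Finite V] (G : SimpleGraph V) (hG : HasC G) : c G ≤ 2 := by
  have hN0 : numVertices G - numComponents G ≠ 0 := (Nat.sub_pos_of_lt hG.1).ne'
  refine (c_le_of_lipCount_le G hG (B := 2 ^ (numVertices G - numComponents G)) (by positivity)
    fun h => by exact_mod_cast lipCount_le_two_pow G h).trans ?_
  rw [← Nat.cast_sub hG.1.le, one_div, Real.pow_rpow_inv_natCast zero_le_two hN0]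

theorem choose_le_exp_mul_pow (n : ℕ) {k : ℕ} (hk : 0 < k) :
    (n.choose k : ℝ) ≤ (Real.exp 1 * n / k) ^ k := by
  have hk' : (0 : ℝ) < k := by exact_mod_cast hk
  calc (n.choose k : ℝ) ≤ (n : ℝ) ^ k / k.factorial := Nat.choose_le_pow_div k n
    _ = ((n : ℝ) / k) ^ k * ((k : ℝ) ^ k / k.factorial) := by
        rw [div_pow]; field_simp
    _ ≤ ((n : ℝ) / k) ^ k * Real.exp k := by
        gcongr
        exact Real.pow_div_factorial_le_exp _ hk'.le k
    _ = _ := by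
        rw [← Real.exp_one_pow k, ← mul_pow]
        congr 1
        ring

theorem choose_le_exp {n m : ℕ} {α : ℝ} (hα : 0 < α) (hn : 0 < n) (hm : α * n ≤ m) :
    (n.choose m : ℝ) ≤ Real.exp ((1 - Real.log α) * m) ∧
      (n.choose (2 * m) : ℝ) * 2 ^ (2 * m) ≤ Real.exp (2 * (1 - Real.log α) * m) := by
  have hn' : (0 : ℝ) < n := by exact_mod_cast hn
  have hm' : (0 : ℝ) < m := (by positivity : (0 : ℝ) < α * n).trans_le hm
  have hm0 : 0 < m := by exact_mod_cast hm'
  have hbase : Real.exp 1 * n / m ≤ Real.exp (1 - Real.log α) := by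
    rw [Real.exp_sub, Real.exp_log hα, mul_div_assoc, div_eq_mul_inv (Real.exp 1)]
    gcongr
    rw [div_le_iff₀ hm', inv_mul_eq_div, le_div_iff₀ hα]
    linarith
  have hpow : ∀ k : ℕ, (Real.exp 1 * n / m) ^ k ≤ Real.exp ((1 - Real.log α) * k) := by
    intro k
    rw [mul_comm (1 - Real.log α), Real.exp_nat_mul]
    gcongr
  refine ⟨(choose_le_exp_mul_pow n hm0).trans (hpow m), ?_⟩
  calc (n.choose (2 * m) : ℝ) * 2 ^ (2 * m)
      ≤ (Real.exp 1 * n / (2 * m : ℕ)) ^ (2 * m) * 2 ^ (2 * m) := by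
        gcongr
        exact choose_le_exp_mul_pow n (by omega)
    -- The factor `2 ^ (2 * m)` cancels the `2` in the denominator `2 * m`.
    _ = (Real.exp 1 * n / m) ^ (2 * m) := by
        rw [← mul_pow]
        congr 1
        push_cast
        field_simp
    _ ≤ _ := (hpow _).trans_eq (by push_cast; ring_nf)

theorem one_sub_pow_le_exp {p : ℝ} (hp : p ≤ 1) (k : ℕ) : (1 - p) ^ k ≤ Real.exp (-(p * k)) := by
  have h : 1 - p ≤ Real.exp (-p) := by linarith [Real.add_one_le_exp (-p)]
  calc (1 - p) ^ k ≤ Real.exp (-p) ^ k := by gcongr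
    _ = _ := by rw [← Real.exp_nat_mul]; ring_nf

/-! ### Events of probability tending to one in the random graph. -/

instance isProbabilityMeasure_randomGraph (n : ℕ) (d : ℝ) :
    IsProbabilityMeasure (randomGraph n d) := by
  unfold randomGraph; infer_instance

theorem tendsto_randomGraph_one {d : ℝ} (s : ∀ n : ℕ, Set (SimpleGraph (Fin n))) {u : ℕ → ℝ}
    (hu : Tendsto u atTop (𝓝 0))
    (hs : ∀ᶠ n in atTop, randomGraph n d (s n)ᶜ ≤ ENNReal.ofReal (u n)) :
    Tendsto (fun n => randomGraph n d (s n)) atTop (𝓝 1) := by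
  have hlim : Tendsto (fun n => 1 - ENNReal.ofReal (u n)) atTop (𝓝 (1 - ENNReal.ofReal 0)) :=
    ENNReal.Tendsto.sub tendsto_const_nhds (ENNReal.tendsto_ofReal hu) (Or.inl ENNReal.one_ne_top)
  rw [ENNReal.ofReal_zero, tsub_zero] at hlim
  refine tendsto_of_tendsto_of_tendsto_of_le_of_le' hlim tendsto_const_nhds ?_
    (Eventually.of_forall fun n => prob_le_one)
  filter_upwards [hs] with n hn
  rw [tsub_le_iff_right]
  calc (1 : ENNReal) = randomGraph n d Set.univ := measure_univ.symm
    _ ≤ randomGraph n d (s n) + randomGraph n d (s n)ᶜ := measure_univ_le_add_compl _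
    _ ≤ _ := by gcongr

/-- The event fails only for the edgeless graph, whose probability is at most `exp (-d(n - 1)/2)`.
-/
theorem tendsto_randomGraph_numComponents_lt {d : ℝ} (hd : 0 < d) :
    Tendsto (fun n : ℕ => randomGraph n d {G | numComponents G < numVertices G}) atTop (𝓝 1) := by
  have hlim : Tendsto (fun n : ℕ => Real.exp (-(d / 2 * ((n : ℝ) - 1)))) atTop (𝓝 0) := by
    refine Real.tendsto_exp_neg_atTop_nhds_zero.comp ?_
    refine Tendsto.const_mul_atTop (by positivity) ?_
    exact tendsto_atTop_add_const_right _ (-1) tendsto_natCast_atTop_atTop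
  refine tendsto_randomGraph_one _ hlim ?_
  filter_upwards [eventually_ge_atTop ⌈d⌉₊, eventually_gt_atTop 0] with n hdn hn
  have hn' : (0 : ℝ) < n := by exact_mod_cast hn
  have hp := coe_edgeProb hd.le (Nat.ceil_le.mp hdn)
  classical
  set E : Finset (Sym2 (Fin n)) := Finset.univ.filter fun e => ¬ e.IsDiag
  have hE : E.card = n.choose 2 := by
    have := Sym2.card_subtype_not_diag (α := Fin n)
    rw [Fintype.card_subtype, Fintype.card_fin] at this
    exact this
  calc randomGraph n d {G | numComponents G < numVertices G}ᶜ
      ≤ SimpleGraph.binomialRandom (Fin n) (edgeProb d n) {G | ∀ e ∈ E, e ∉ G.edgeSet} := by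
        refine measure_mono fun G hG e _ he => hG ?_
        induction e with
        | _ x y =>
          by_contra hlt
          have hinj := (Function.Surjective.bijective_of_nat_card_le
            (f := G.connectedComponentMk) Quot.mk_surjective (not_lt.mp hlt)).injective
          rw [SimpleGraph.mem_edgeSet] at he
          exact he.ne (hinj (SimpleGraph.ConnectedComponent.sound he.reachable))
    _ ≤ ENNReal.ofReal ((1 - (edgeProb d n : ℝ)) ^ E.card) :=
        binomialRandom_no_edge_le _ E fun e he => (Finset.mem_filter.mp he).2
    _ ≤ _ := by
        refine ENNReal.ofReal_le_ofReal ((one_sub_pow_le_exp (edgeProb d n).2.2 _).trans_eq ?_)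
        rw [hp, hE, Nat.cast_choose_two]
        congr 2
        field_simp

theorem tendsto_exponent {α β : ℝ} (hα : 0 < 1 - 2 * α) :
    Tendsto (fun n : ℕ => (Real.log n + 2 * β * (α * n + 1)) / (n - 2 * (α * n + 1))) atTop
      (𝓝 (2 * β * α / (1 - 2 * α))) := by
  have h1 : Tendsto (fun n : ℕ => Real.log n / (n : ℝ)) atTop (𝓝 0) :=
    (Real.isLittleO_log_id_atTop.tendsto_div_nhds_zero).comp tendsto_natCast_atTop_atTop
  have h2 : Tendsto (fun n : ℕ => 1 / (n : ℝ)) atTop (𝓝 0) := tendsto_one_div_atTop_nhds_zero_nat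
  have h3 : Tendsto (fun n : ℕ => (Real.log n / (n : ℝ) + 2 * β * (α + 1 / (n : ℝ))) /
      (1 - 2 * (α + 1 / (n : ℝ)))) atTop
      (𝓝 ((0 + 2 * β * (α + 0)) / (1 - 2 * (α + 0)))) := by
    refine (h1.add ((h2.const_add α).const_mul _)).div
      (((h2.const_add α).const_mul _).const_sub _) ?_
    rw [add_zero]; exact hα.ne'
  rw [zero_add, add_zero] at h3
  refine h3.congr' ?_
  filter_upwards [eventually_gt_atTop 0] with n hn
  have hn' : (0 : ℝ) < n := by exact_mod_cast hn
  rw [← mul_div_mul_right _ _ hn'.ne']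
  congr 1 <;> field_simp

theorem c_le_exp_of_not_hasHole {n m : ℕ} (G : SimpleGraph (Fin n)) {α : ℝ} (hα : 0 < α)
    (hα1 : α < 1) (hn : 0 < n) (hm : α * n ≤ m) (hm' : m < α * n + 1)
    (hmn : 2 * (α * n + 1) < n) (hG : ¬ HasHole G m) :
    HasC G ∧ c G ≤ Real.exp ((Real.log n + 2 * (1 - Real.log α) * (α * n + 1)) /
      (n - 2 * (α * n + 1))) := by
  have hn' : (0 : ℝ) < n := by exact_mod_cast hn
  have hm0 : 0 < m := by
    have : (0 : ℝ) < m := (by positivity : (0 : ℝ) < α * n).trans_le hm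
    exact_mod_cast this
  have hlog : Real.log α < 0 := Real.log_neg hα hα1
  have hlogn : 0 ≤ Real.log n := Real.log_natCast_nonneg n
  have h2mn : 2 * m ≤ n := by
    have : (2 : ℝ) * m ≤ n := by linarith
    exact_mod_cast this
  have hV : numVertices G = n := by simp [numVertices]
  have hk := numComponents_lt_of_not_hasHole G hG
  have hC := hasC_of_numComponents_lt G (by omega)
  have hk' : (numComponents G : ℝ) < 2 * m := by exact_mod_cast hk
  refine ⟨hC, (c_le_of_lipCount_le G hC (B := Real.exp (Real.log n + 2 * (1 - Real.log α) * m))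
    (by positivity) fun h => ?_).trans ?_⟩
  · have h1 := lipCount_le_of_not_hasHole G hm0 (by simpa using h2mn) hG h
    rw [Fintype.card_fin] at h1
    calc (lipCount G h : ℝ) ≤ (n * n.choose (2 * m) *
          (2 ^ (2 * m) * (h + 1) ^ (numVertices G - numComponents G)) : ℕ) := by exact_mod_cast h1
      _ = n * (n.choose (2 * m) * 2 ^ (2 * m)) *
          ((h : ℝ) + 1) ^ (numVertices G - numComponents G) := by push_cast; ring
      _ ≤ _ := by
          rw [Real.exp_add, Real.exp_log hn']
          gcongr
          exact (choose_le_exp hα hn hm).2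
  · rw [← Real.exp_mul, mul_one_div, hV]
    refine Real.exp_le_exp.mpr (div_le_div₀ ?_ ?_ (by linarith) (by linarith))
    · have : 0 < 1 - Real.log α := by linarith
      positivity
    · have : 0 < 1 - Real.log α := by linarith
      gcongr

/-- The hypothesis `hdα` acts twice: it makes holes exponentially unlikely, and it puts the limiting
exponent strictly below `d * α ^ 2 / (1 - 2 * α)`, which absorbs the `ln n` and rounding terms for
large `n`. -/
theorem tendsto_randomGraph_c_le_exp {d α : ℝ} (hd : 0 < d) (hα : 0 < α) (hα2 : α < 1 / 2)
    (hdα : 2 * (1 - Real.log α) < d * α) :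
    Tendsto (fun n : ℕ => randomGraph n d
      {G | HasC G ∧ c G ≤ Real.exp (d * α ^ 2 / (1 - 2 * α))}) atTop (𝓝 1) := by
  have hα' : 0 < 1 - 2 * α := by linarith
  have hδ : 0 < d * α - 2 * (1 - Real.log α) := by linarith
  have hlim : Tendsto (fun n : ℕ => Real.exp (-((d * α - 2 * (1 - Real.log α)) * α * n)))
      atTop (𝓝 0) :=
    Real.tendsto_exp_neg_atTop_nhds_zero.comp
      (Tendsto.const_mul_atTop (by positivity) tendsto_natCast_atTop_atTop)
  refine tendsto_randomGraph_one _ hlim ?_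
  have hexp : 2 * (1 - Real.log α) * α / (1 - 2 * α) < d * α ^ 2 / (1 - 2 * α) :=
    div_lt_div_of_pos_right (by nlinarith) hα'
  have hlarge : ∀ᶠ n : ℕ in atTop, 2 < (1 - 2 * α) * (n : ℝ) :=
    (Tendsto.const_mul_atTop hα' tendsto_natCast_atTop_atTop).eventually_gt_atTop 2
  filter_upwards [(tendsto_exponent hα').eventually_lt_const hexp, hlarge,
    eventually_ge_atTop ⌈d⌉₊, eventually_gt_atTop 0] with n hn hlarge hdn hn0
  have hn0' : (0 : ℝ) < n := by exact_mod_cast hn0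
  have hp := coe_edgeProb hd.le (Nat.ceil_le.mp hdn)
  set m := ⌈α * n⌉₊
  have hm : α * n ≤ m := Nat.le_ceil _
  have hm' : m < α * n + 1 := Nat.ceil_lt_add_one (by positivity)
  calc randomGraph n d {G | HasC G ∧ c G ≤ Real.exp (d * α ^ 2 / (1 - 2 * α))}ᶜ
      ≤ SimpleGraph.binomialRandom (Fin n) (edgeProb d n) {G | HasHole G m} := by
        refine measure_mono fun G hG => ?_
        by_contra hhole
        obtain ⟨hC, hc⟩ := c_le_exp_of_not_hasHole G hα (by linarith) hn0 hm hm' (by linarith) hhole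
        exact hG ⟨hC, hc.trans (Real.exp_le_exp.mpr hn.le)⟩
    _ ≤ _ := binomialRandom_hasHole_le _ m
    _ ≤ _ := by
        refine ENNReal.ofReal_le_ofReal ?_
        rw [Fintype.card_fin]
        calc _ ≤ Real.exp ((1 - Real.log α) * m) ^ 2 *
              Real.exp (-(edgeProb d n * (m ^ 2 : ℕ))) := by
              gcongr
              · exact pow_nonneg (by linarith [(edgeProb d n).2.2]) _
              · exact (choose_le_exp hα hn0 hm).1
              · exact one_sub_pow_le_exp (edgeProb d n).2.2 _
          _ ≤ _ := by
              rw [← Real.exp_nat_mul, ← Real.exp_add, hp]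
              refine Real.exp_le_exp.mpr ?_
              -- One factor `m ≥ αn` is spent against `1 / n`, leaving an exponent linear in `m`.
              have h1 : d * α * m ≤ d / n * (m ^ 2 : ℕ) := by
                push_cast
                rw [div_mul_eq_mul_div, le_div_iff₀ hn0']
                nlinarith [mul_le_mul_of_nonneg_left hm (by positivity : 0 ≤ d * (m : ℝ))]
              have h2 := mul_le_mul_of_nonneg_left hm hδ.le
              push_cast at h1 ⊢
              linarith

/-! ### Choice of `α` and the conclusion. -/

theorem eventually_exp_bound : ∀ᶠ d : ℝ in atTop, ∃ α : ℝ, 0 < α ∧ α < 1 / 2 ∧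
    2 * (1 - Real.log α) < d * α ∧
    Real.exp (d * α ^ 2 / (1 - 2 * α)) ≤ 1 + 4 * Real.log d ^ 2 / d := by
  have hlit : ∀ᶠ d : ℝ in atTop, ‖Real.log d ^ 4‖ ≤ 1 / 16 * ‖id d‖ :=
    (Real.isLittleO_pow_log_id_atTop (n := 4)).bound (by norm_num)
  filter_upwards [hlit, Real.tendsto_log_atTop.eventually_ge_atTop 5, eventually_gt_atTop 0]
    with d hd hL hd0
  set L := Real.log d with hLdef
  rw [Real.norm_of_nonneg (by positivity), id, Real.norm_of_nonneg hd0.le] at hd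
  have hL4 : 16 * L ^ 4 ≤ d := by linarith
  have hL3 : 4 * L ^ 3 ≤ d := by nlinarith [pow_pos (by linarith : 0 < L) 3]
  have hL2 : 16 * L ^ 2 ≤ d := by nlinarith [pow_pos (by linarith : 0 < L) 2]
  have hL1 : 16 * L ≤ d := by nlinarith
  -- With this `α` the condition `2(1 - ln α) < dα` reduces to `ln (2(L - 1)) > 2`, which holds for
  -- `L ≥ 5` because `e² < 8`.
  refine ⟨2 * (L - 1) / d, by apply div_pos <;> linarith, ?_, ?_, ?_⟩
  · rw [div_lt_iff₀ hd0]; linarith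
  · have h2 : 2 < Real.log (2 * (L - 1)) := by
      rw [Real.lt_log_iff_exp_lt (by linarith)]
      have h := Real.exp_one_lt_d9
      have : Real.exp 2 = Real.exp 1 * Real.exp 1 := by rw [← Real.exp_add]; norm_num
      nlinarith [Real.exp_pos 1]
    rw [Real.log_div (by linarith) hd0.ne', mul_div_cancel₀ _ hd0.ne', ← hLdef]
    linarith
  -- The exponent is at most `z`, which lies `4L/d` below the target `4L²/d`; this gap pays for the
  -- `z ^ 2` in `exp z ≤ 1 + z + z ^ 2`.
  · set z := (4 * L ^ 2 - 4 * L) / d with hz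
    have hz0 : 0 ≤ z := div_nonneg (by nlinarith) hd0.le
    have hz1 : z ≤ 1 := by rw [hz, div_le_one hd0]; nlinarith
    have hy : d * (2 * (L - 1) / d) ^ 2 / (1 - 2 * (2 * (L - 1) / d)) ≤ z := by
      have hpos : 0 < d - 4 * (L - 1) := by linarith
      have : d * (2 * (L - 1) / d) ^ 2 / (1 - 2 * (2 * (L - 1) / d)) =
          4 * (L - 1) ^ 2 / (d - 4 * (L - 1)) := by
        have h1 : 1 - 2 * (2 * (L - 1) / d) = (d - 4 * (L - 1)) / d := by field_simp; ring
        rw [h1]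
        field_simp
        ring
      rw [this, hz, div_le_div_iff₀ hpos hd0]
      nlinarith [mul_nonneg (by linarith : 0 ≤ L - 1)
        (by nlinarith : 0 ≤ d - 4 * L * (L - 1))]
    have hexp := (abs_le.mp (Real.abs_exp_sub_one_sub_id_le (by rwa [abs_of_nonneg hz0]))).2
    have hzz : z ^ 2 ≤ 4 * L / d := by
      have hz' : z ≤ 4 * L ^ 2 / d := by rw [hz]; gcongr; linarith
      calc z ^ 2 ≤ (4 * L ^ 2 / d) ^ 2 := by gcongr
        _ = 4 * L * (4 * L ^ 3) / (d * d) := by rw [div_pow]; ring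
        _ ≤ 4 * L * d / (d * d) := by gcongr
        _ = _ := by field_simp
    have hsum : z + 4 * L / d = 4 * L ^ 2 / d := by rw [hz]; ring
    linarith [Real.exp_le_exp.mpr hy]

end LipschitzCount

theorem theorem3p2p2 :
    ∃ C : ℝ, ∀ d : ℝ, 0 < d →
      Tendsto
        (fun n : ℕ => LipschitzCount.randomGraph n d
          {G : SimpleGraph (Fin n) | LipschitzCount.HasC G ∧
            LipschitzCount.c G ≤ 1 + 4 * (Real.log d) ^ 2 / d + C / d})
        atTop (𝓝 1) := by
  obtain ⟨d₀, hd₀⟩ := eventually_atTop.mp LipschitzCount.eventually_exp_bound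
  -- For `d ≥ d₀` the bound holds even without the term `C/d`; the constant only serves to make `C/d
  -- ≥ 1` when `d < d₀`.
  refine ⟨max d₀ 0, fun d hd => ?_⟩
  have hC : 0 ≤ max d₀ 0 / d := div_nonneg (le_max_right _ _) hd.le
  rcases le_or_gt d₀ d with h | h
  · obtain ⟨α, hα, hα2, hdα, hexp⟩ := hd₀ d h
    refine tendsto_of_tendsto_of_tendsto_of_le_of_le
      (LipschitzCount.tendsto_randomGraph_c_le_exp hd hα hα2 hdα) tendsto_const_nhds
      (fun n => measure_mono fun G hG => ⟨hG.1, hG.2.trans (by linarith)⟩) fun n => prob_le_one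
  · have h1 : 1 ≤ max d₀ 0 / d := by
      rw [le_div_iff₀ hd, one_mul]
      exact h.le.trans (le_max_left _ _)
    have h2 : 0 ≤ 4 * (Real.log d) ^ 2 / d := by positivity
    refine tendsto_of_tendsto_of_tendsto_of_le_of_le
      (LipschitzCount.tendsto_randomGraph_numComponents_lt hd) tendsto_const_nhds
      (fun n => measure_mono fun G hG => ?_) fun n => prob_le_one
    have hG' := LipschitzCount.hasC_of_numComponents_lt G hG
    exact ⟨hG', (LipschitzCount.c_le_two G hG').trans (by linarith)⟩
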